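/- Let $K\ge 0$, $\mu\in\mathbb R^2$, $\alpha_k=(\alpha_{kij})\in\mathbb R^{2\times 2}$ and $\beta_{k1},\beta_{k2}>0$ for $k=1,\dots,K$. Let $N=(N_1,N_2)$ be a bivariate multi-kernel Hawkes process on the whole real line: $N_1,N_2$ are simple, locally finite counting processes, adapted to a filtration $(\mathcal F_t)_{t\in\mathbb R}$, almost surely without common jumps, and the non-negative process $$\lambda_t=\mu+\sum_{k=1}^K\lambda_k(t),\qquad \lambda_k(t)=\int_{(-\infty,t)}h_k(t-u)\,\mathrm dN_u,\qquad (h_k(t))_{ij}=\alpha_{kij}\,e^{-\beta_{ki}t},$$ (the integrals being almost surely convergent) is the $(\mathcal F_t)$-intensity of $N$, that is, $\mathbb E\int_{\mathbb R} C_t\,\mathrm dN_j(t)=\mathbb E\int_{\mathbb R} C_t\lambda_j(t)\,\mathrm dt$ for $j=1,2$ and every non-negative predictable process $C$. Put $$\Lambda_t=\begin{bmatrix}\lambda_1(t)\\ \vdots\\ \lambda_K(t)\end{bmatrix}\in\mathbb R^{2K},\quad \alpha=\begin{bmatrix}\alpha_1\\ \vdots\\ \alpha_K\end{bmatrix}\in\mathbb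 R^{2K\times 2},\quad \beta=\mathrm{Dg}(\beta_{11},\beta_{12},\dots,\beta_{K1},\beta_{K2}),\quad J=[\,I_2\ \cdots\ I_2\,]\in\mathbb R^{2\times 2K},$$ where $\mathrm{Dg}(\cdot)$ is the diagonal matrix with the given diagonal. Assume that the process is in a steady state, that is, the law of $\Lambda_t$ does not depend on $t\in\mathbb R$, and that $\Lambda_t$ is square integrable, so that $\mathbb E[\Lambda_t\Lambda_t^\top]$ exists. Then for every $t\in\mathbb R$ the matrix $\mathbb E[\Lambda_t\Lambda_t^\top]$ satisfies the Sylvester equation $$(\beta-\alpha J)\,\mathbb E[\Lambda_t\Lambda_t^\top]+\mathbb E[\Lambda_t\Lambda_t^\top]\,(\beta-J^\top\alpha^\top)=R_t,\qquad R_t=\alpha\mu\,\mathbb E[\Lambda_t^\top]+\mathbb E[\Lambda_t]\,\mu^\top\alpha^\top+\alpha\,\mathrm{Dg}(\mathbb E[\lambda_t])\,\alpha^\top.$$ Equivalently, it satisfies the linear system $$\bigl(I\otimes(\beta-\alpha J)+(\beta-\alpha J)\otimes I\bigr)\,\mathrm{vec}\bigl(\mathbb E[\Lambda_t\Lambda_t^\top]\bigr)=\mathrm{vec}(R_t),$$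 where $\otimes$ is the Kronecker product and $\mathrm{vec}$ stacks the columns of a matrix; more generally, a matrix $X\in\mathbb R^{2K\times 2K}$ solves $(\beta-\alpha J)X+X(\beta-J^\top\alpha^\top)=R_t$ if and only if $\bigl(I\otimes(\beta-\alpha J)+(\beta-\alpha J)\otimes I\bigr)\mathrm{vec}(X)=\mathrm{vec}(R_t)$. -/

import Mathlib

open MeasureTheory ProbabilityTheory
open scoped ENNReal Matrix Kronecker

namespace MultiKernelHawkes

noncomputable section

/-- The predictable σ-algebra on `ℝ × Ω` of a filtration indexed by the whole real line: it is
generated by the sets `(s, ∞) × A` with `A ∈ ℱ s`. -/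
@[reducible]
def predictable {Ω : Type*} {m : MeasurableSpace Ω} (ℱ : Filtration ℝ m) :
    MeasurableSpace (ℝ × Ω) :=
  MeasurableSpace.generateFrom
    {S | ∃ (s : ℝ) (A : Set Ω), MeasurableSet[ℱ s] A ∧ S = Set.Ioi s ×ˢ A}

/-- The counting measure of the jump times: if `T j ω` is the set of jump times of the `j`-th
component, then `counting T j ω B` is the number of jumps in `B`, so that integration against it
is integration against `dN_j`, and `N_j(t) - N_j(s) = counting T j ω (Set.Ioc s t)`. -/
def counting {Ω : Type*} (T : Fin 2 → Ω → Set ℝ) (j : Fin 2) (ω : Ω) : Measure ℝ :=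
  Measure.count.restrict (T j ω)

/-- The `k`-th kernel `h_k(t)`, with entries `α_{kij} exp (-β_{ki} t)`. -/
def kernel {K : ℕ} (α : Fin K → Matrix (Fin 2) (Fin 2) ℝ) (β : Fin K → Fin 2 → ℝ)
    (k : Fin K) (t : ℝ) : Matrix (Fin 2) (Fin 2) ℝ :=
  α k ⊙ Matrix.of fun i _ => Real.exp (-(β k i) * t)

/-- The stacked vector `Λ_t` with the entries
`λ_{ki}(t) = ∑_j ∫_{(-∞, t)} (h_k)_{ij}(t - u) dN_j(u)`, indexed by the pairs `(k, i)`. -/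
def stacked {Ω : Type*} {K : ℕ} (α : Fin K → Matrix (Fin 2) (Fin 2) ℝ)
    (β : Fin K → Fin 2 → ℝ) (T : Fin 2 → Ω → Set ℝ) (t : ℝ) (ω : Ω) : Fin K × Fin 2 → ℝ :=
  fun p => ∑ j, ∫ u in Set.Iio t, kernel α β p.1 (t - u) p.2 j ∂(counting T j ω)

/-- The intensity `λ_t = μ + ∑_k λ_k(t)`. -/
def intensity {Ω : Type*} {K : ℕ} (μ : Fin 2 → ℝ) (α : Fin K → Matrix (Fin 2) (Fin 2) ℝ)
    (β : Fin K → Fin 2 → ℝ) (T : Fin 2 → Ω → Set ℝ) (t : ℝ) (ω : Ω) : Fin 2 → ℝ :=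
  fun i => μ i + ∑ k, stacked α β T t ω (k, i)

/-- `T 0 ω` and `T 1 ω` are the sets of jump times of a bivariate multi-kernel Hawkes process on
the real line with base rate `μ` and kernels `h_k`, relative to the filtration `ℱ`. -/
structure IsHawkes {Ω : Type*} {m : MeasurableSpace Ω} {K : ℕ} (P : Measure Ω)
    (ℱ : Filtration ℝ m) (μ : Fin 2 → ℝ) (α : Fin K → Matrix (Fin 2) (Fin 2) ℝ)
    (β : Fin K → Fin 2 → ℝ) (T : Fin 2 → Ω → Set ℝ) : Prop where
  /-- There are finitely many jumps in every bounded time interval. -/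
  locallyFinite : ∀ j ω a b, (T j ω ∩ Set.Icc a b).Finite
  /-- The two components almost surely have no common jump. -/
  noCommonJumps : ∀ᵐ ω ∂P, Disjoint (T 0 ω) (T 1 ω)
  /-- The increments of the counting processes are adapted. -/
  adapted : ∀ j s t, Measurable[ℱ t] fun ω => counting T j ω (Set.Ioc s t)
  /-- The integrals that define the components of the intensity converge almost surely. -/
  integrable : ∀ᵐ ω ∂P, ∀ t k i j,
    IntegrableOn (fun u => kernel α β k (t - u) i j) (Set.Iio t) (counting T j ω)
  /-- The intensity is non-negative. -/
  nonneg : ∀ᵐ ω ∂P, ∀ t i, 0 ≤ intensity μ α β T t ω i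
  /-- `λ_j` is the stochastic intensity of `N_j`: `E ∫ C_t dN_j(t) = E ∫ C_t λ_j(t) dt` for all
  non-negative predictable processes `C`. -/
  isIntensity : ∀ (j : Fin 2) (C : ℝ × Ω → ℝ≥0∞), Measurable[predictable ℱ] C →
    ∫⁻ ω, ∫⁻ t, C (t, ω) ∂(counting T j ω) ∂P =
      ∫⁻ ω, ∫⁻ t, C (t, ω) * ENNReal.ofReal (intensity μ α β T t ω j) ∂volume ∂P

/-- Steady state: the law of `Λ_t` does not depend on `t`. -/
def IsSteadyState {Ω : Type*} {m : MeasurableSpace Ω} {K : ℕ} (P : Measure Ω)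
    (α : Fin K → Matrix (Fin 2) (Fin 2) ℝ) (β : Fin K → Fin 2 → ℝ)
    (T : Fin 2 → Ω → Set ℝ) : Prop :=
  ∀ t, IdentDistrib (stacked α β T t) (stacked α β T 0) P P

/-- The `2K × 2` matrix with the blocks `α_1, …, α_K`. -/
def stackedAlpha {K : ℕ} (α : Fin K → Matrix (Fin 2) (Fin 2) ℝ) :
    Matrix (Fin K × Fin 2) (Fin 2) ℝ :=
  Matrix.of fun p j => α p.1 p.2 j

/-- The diagonal `2K × 2K` matrix of the decay rates `β_{ki}`. -/
def stackedBeta {K : ℕ} (β : Fin K → Fin 2 → ℝ) :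
    Matrix (Fin K × Fin 2) (Fin K × Fin 2) ℝ :=
  Matrix.diagonal fun p => β p.1 p.2

/-- The `2 × 2K` matrix `J = [I ⋯ I]`. -/
def matJ (K : ℕ) : Matrix (Fin 2) (Fin K × Fin 2) ℝ :=
  Matrix.of fun i p => if i = p.2 then 1 else 0

/-- The vector `E[X]`. -/
def mean {Ω ι : Type*} {m : MeasurableSpace Ω} (P : Measure Ω) (X : Ω → ι → ℝ) : ι → ℝ :=
  fun p => ∫ ω, X ω p ∂P

/-- The matrix `E[X Xᵀ]`. -/
def secondMoment {Ω ι : Type*} {m : MeasurableSpace Ω} (P : Measure Ω) (X : Ω → ι → ℝ) :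
    Matrix ι ι ℝ :=
  Matrix.of fun p q => ∫ ω, X ω p * X ω q ∂P

/-- The right-hand side `α μ E[Λᵀ] + E[Λ] μᵀ αᵀ + α Dg(E[λ]) αᵀ`. -/
def rhs {Ω : Type*} {m : MeasurableSpace Ω} {K : ℕ} (P : Measure Ω)
    (μ : Fin 2 → ℝ) (α : Fin K → Matrix (Fin 2) (Fin 2) ℝ)
    (β : Fin K → Fin 2 → ℝ) (T : Fin 2 → Ω → Set ℝ) (t : ℝ) :
    Matrix (Fin K × Fin 2) (Fin K × Fin 2) ℝ :=
  stackedAlpha α * Matrix.vecMulVec μ (mean P (stacked α β T t))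
    + Matrix.vecMulVec (mean P (stacked α β T t)) μ * (stackedAlpha α)ᵀ
    + stackedAlpha α * Matrix.diagonal (mean P (intensity μ α β T t)) * (stackedAlpha α)ᵀ

end

end MultiKernelHawkes

/-! The Sylvester equation follows from an exact pathwise formula for `Λ_p(t) Λ_q(t)` combined with
stationarity; no differential equation or Itô formula is needed.

Each `Λ_p(t)` is a sum over `j` of `α_{pj}` times an exponentially damped sum over the jumps of
`N_j` before `t`, so the product is a sum over pairs of jumps `(v, w)`. Split the pairs by `v < w`,
`w < v`, `v = w`. For `v < w` the weight `exp (-β_p (t - v)) * exp (-β_q (t - w))` equals `exp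
(-(β_p + β_q) (t - w)) * exp (-β_p (w - v))`, and summing over `v < w` rebuilds `Λ_p(w)`. Pairs with
`v = w` come only from one component, since there are no common jumps, and each such jump has mass
one. This is `stacked_mul_stacked`.

All three terms are now damped integrals of a function of `Λ_w` against `dN_l(w)`. The integrands
are predictable because `Λ_w` uses jumps strictly before `w`, so in expectation `dN_l(w)` may be
replaced by `λ_l(w) dw`. As `λ_l` is itself a function of `Λ`, stationarity makes the expectation
constant in `w`, and the time integral contributes only `1 / (β_p + β_q)`: this is
`IsHawkes.integral_setIntegral_exp_mul`. Multiplying by `β_p + β_q` and expanding `λ_l = μ_l + ∑_k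
Λ_{kl}` gives the equation entry by entry. -/

namespace MultiKernelHawkes

/-! ### Measurability of integrals against random measures. -/

section RandomMeasure

variable {Ω : Type*}

/-- A random locally finite measure restricted to `(a, t]` is measurable as soon as its values on
the intervals `(s, r]` with `r ≤ t` are. -/
lemma measurable_restrict_Ioc {m : MeasurableSpace Ω} {n : Ω → Measure ℝ}
    [∀ ω, IsLocallyFiniteMeasure (n ω)] {t : ℝ}
    (h : ∀ s, ∀ r ≤ t, Measurable fun ω => n ω (Set.Ioc s r)) (a : ℝ) :
    Measurable fun ω => (n ω).restrict (Set.Ioc a t) := by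
  have : ∀ ω, IsFiniteMeasure ((n ω).restrict (Set.Ioc a t)) := fun ω =>
    ⟨by simpa using measure_Ioc_lt_top⟩
  refine Measurable.measure_of_isPiSystem
    (BorelSpace.measurable_eq.trans (borel_eq_generateFrom_Ioc ℝ))
    (isPiSystem_Ioc (fun x : ℝ => x) (fun x : ℝ => x)) ?_ (by simpa using h a t le_rfl)
  rintro _ ⟨l, u, -, rfl⟩
  simp_rw [Measure.restrict_apply measurableSet_Ioc, Set.Ioc_inter_Ioc]
  exact h _ _ inf_le_right

lemma iUnion_Ioc_neg_natCast (t : ℝ) : ⋃ k : ℕ, Set.Ioc (-(k : ℝ)) t = Set.Iic t := by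
  ext v
  simp only [Set.mem_iUnion, Set.mem_Ioc, Set.mem_Iic]
  refine ⟨fun ⟨_, h⟩ => h.2, fun h => ?_⟩
  obtain ⟨k, hk⟩ := exists_nat_gt (-v)
  exact ⟨k, by linarith, h⟩

lemma iUnion_Ioc_neg_natCast_natCast : ⋃ k : ℕ, Set.Ioc (-(k : ℝ)) k = Set.univ := by
  ext v
  simp only [Set.mem_iUnion, Set.mem_Ioc, Set.mem_univ, iff_true]
  obtain ⟨k, hk⟩ := exists_nat_gt |v|
  have := abs_lt.1 hk
  exact ⟨k, this.1, this.2.le⟩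

/-- Only masses of intervals ending at or before `t` enter the hypothesis, so the σ-algebra may be
taken to be `ℱ t`; this is what yields predictability later. -/
lemma measurable_setLIntegral_Iic {m : MeasurableSpace Ω} {n : Ω → Measure ℝ}
    [∀ ω, IsLocallyFiniteMeasure (n ω)] {t : ℝ}
    (h : ∀ s, ∀ r ≤ t, Measurable fun ω => n ω (Set.Ioc s r)) {g : ℝ → ℝ≥0∞}
    (hg : Measurable g) : Measurable fun ω => ∫⁻ v in Set.Iic t, g v ∂n ω := by
  have key : ∀ ω, ∫⁻ v in Set.Iic t, g v ∂n ω
      = ⨆ k : ℕ, ∫⁻ v in Set.Ioc (-(k : ℝ)) t, g v ∂n ω := fun ω => by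
    rw [← iUnion_Ioc_neg_natCast, setLIntegral_iUnion_of_directed]
    refine Monotone.directed_le fun i j hij => Set.Ioc_subset_Ioc_left ?_
    simpa using hij
  simp_rw [key]
  exact .iSup fun k => (Measure.measurable_lintegral hg).comp (measurable_restrict_Ioc h _)

/-- The total masses need not be bounded in `ω`, so `n` is normalized to a finite kernel and the
mass is multiplied back. -/
lemma measurable_lintegral_of_isFiniteMeasure {m : MeasurableSpace Ω} {n : Ω → Measure ℝ}
    [∀ ω, IsFiniteMeasure (n ω)] (hn : Measurable n) {C : ℝ × Ω → ℝ≥0∞} (hC : Measurable C) :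
    Measurable fun ω => ∫⁻ v, C (v, ω) ∂n ω := by
  have hu : Measurable fun ω => n ω Set.univ := (Measure.measurable_coe .univ).comp hn
  let κ : Kernel Ω ℝ :=
    { toFun := fun ω => (n ω Set.univ)⁻¹ • n ω
      measurable' := by
        refine Measure.measurable_of_measurable_coe _ fun s hs => ?_
        exact hu.inv.mul ((Measure.measurable_coe hs).comp hn) }
  have : IsFiniteKernel κ := ⟨⟨1, ENNReal.one_lt_top, fun ω => by
    simp [κ, ENNReal.inv_mul_le_one]⟩⟩
  have key : ∀ ω, ∫⁻ v, C (v, ω) ∂n ω = n ω Set.univ * ∫⁻ v, C (v, ω) ∂κ ω := fun ω => by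
    -- For zero mass the normalizing factor is `∞` and cannot be cancelled.
    rcases eq_or_ne (n ω) 0 with h0 | h0
    · simp [h0]
    · change _ = n ω Set.univ * ∫⁻ v, C (v, ω) ∂((n ω Set.univ)⁻¹ • n ω)
      rw [lintegral_smul_measure, smul_eq_mul, ← mul_assoc, ENNReal.mul_inv_cancel
        (by simpa using h0) (measure_ne_top _ _), one_mul]
  simp_rw [key]
  exact hu.mul hC.lintegral_kernel_prod_left'

/-- The integral of a measurable process against a random locally finite measure is a random
variable. -/
lemma measurable_lintegral_of_isLocallyFiniteMeasure {m : MeasurableSpace Ω} {n : Ω → Measure ℝ}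
    [∀ ω, IsLocallyFiniteMeasure (n ω)]
    (h : ∀ s r, Measurable fun ω => n ω (Set.Ioc s r)) {C : ℝ × Ω → ℝ≥0∞} (hC : Measurable C) :
    Measurable fun ω => ∫⁻ v, C (v, ω) ∂n ω := by
  have key : ∀ ω, ∫⁻ v, C (v, ω) ∂n ω
      = ⨆ k : ℕ, ∫⁻ v in Set.Ioc (-(k : ℝ)) k, C (v, ω) ∂n ω := fun ω => by
    rw [← setLIntegral_univ, ← iUnion_Ioc_neg_natCast_natCast, setLIntegral_iUnion_of_directed]
    refine Monotone.directed_le fun i j hij => Set.Ioc_subset_Ioc ?_ ?_ <;> simpa using hij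
  simp_rw [key]
  refine .iSup fun k => ?_
  have : ∀ ω, IsFiniteMeasure ((n ω).restrict (Set.Ioc (-(k : ℝ)) k)) := fun ω =>
    ⟨by simpa using measure_Ioc_lt_top⟩
  exact measurable_lintegral_of_isFiniteMeasure (measurable_restrict_Ioc (fun s r _ => h s r) _) hC

/-- The expectation of the integral of a measurable process against a random measure. -/
lemma integrable_integral_and_integral_integral_eq {m : MeasurableSpace Ω} {P : Measure Ω}
    {n : Ω → Measure ℝ} [∀ ω, IsLocallyFiniteMeasure (n ω)]
    (h : ∀ s r, Measurable fun ω => n ω (Set.Ioc s r)) {G : ℝ × Ω → ℝ} (hG : Measurable G)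
    (hfin : ∫⁻ ω, ∫⁻ v, ‖G (v, ω)‖ₑ ∂n ω ∂P ≠ ∞) :
    Integrable (fun ω => ∫ v, G (v, ω) ∂n ω) P ∧
      ∫ ω, ∫ v, G (v, ω) ∂n ω ∂P = (∫⁻ ω, ∫⁻ v, ENNReal.ofReal (G (v, ω)) ∂n ω ∂P).toReal
        - (∫⁻ ω, ∫⁻ v, ENNReal.ofReal (-G (v, ω)) ∂n ω ∂P).toReal := by
  have hpos : Measurable fun ω => ∫⁻ v, ENNReal.ofReal (G (v, ω)) ∂n ω :=
    measurable_lintegral_of_isLocallyFiniteMeasure h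
      (C := fun z => ENNReal.ofReal (G z)) (by fun_prop)
  have hneg : Measurable fun ω => ∫⁻ v, ENNReal.ofReal (-G (v, ω)) ∂n ω :=
    measurable_lintegral_of_isLocallyFiniteMeasure h
      (C := fun z => ENNReal.ofReal (-G z)) (by fun_prop)
  have hnorm : Measurable fun ω => ∫⁻ v, ‖G (v, ω)‖ₑ ∂n ω :=
    measurable_lintegral_of_isLocallyFiniteMeasure h (C := fun z => ‖G z‖ₑ) (by fun_prop)
  have hposfin : ∫⁻ ω, ∫⁻ v, ENNReal.ofReal (G (v, ω)) ∂n ω ∂P ≠ ∞ :=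
    ne_top_of_le_ne_top hfin (lintegral_mono fun ω => lintegral_mono fun v =>
      Real.ofReal_le_enorm _)
  have hnegfin : ∫⁻ ω, ∫⁻ v, ENNReal.ofReal (-G (v, ω)) ∂n ω ∂P ≠ ∞ :=
    ne_top_of_le_ne_top hfin (lintegral_mono fun ω => lintegral_mono fun v => by
      simpa using Real.ofReal_le_enorm (-G (v, ω)))
  -- Splitting the inner integral into its two parts needs integrability of `G (·, ω)`, which `hfin`
  -- gives only for almost every `ω`.
  have hae : ∀ᵐ ω ∂P, (∫⁻ v, ENNReal.ofReal (G (v, ω)) ∂n ω).toReal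
      - (∫⁻ v, ENNReal.ofReal (-G (v, ω)) ∂n ω).toReal = ∫ v, G (v, ω) ∂n ω := by
    filter_upwards [ae_lt_top hnorm hfin] with ω hω
    rw [integral_eq_lintegral_pos_part_sub_lintegral_neg_part]
    exact ⟨(hG.comp measurable_prodMk_right).aestronglyMeasurable, hω⟩
  have hi₁ := integrable_toReal_of_lintegral_ne_top hpos.aemeasurable hposfin
  have hi₂ := integrable_toReal_of_lintegral_ne_top hneg.aemeasurable hnegfin
  refine ⟨(hi₁.sub hi₂).congr hae, ?_⟩
  rw [← integral_congr_ae hae, integral_sub hi₁ hi₂,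
    integral_toReal hpos.aemeasurable (ae_lt_top hpos hposfin),
    integral_toReal hneg.aemeasurable (ae_lt_top hneg hnegfin)]

end RandomMeasure

/-! ### The predictable σ-algebra. -/

section Predictable

variable {Ω : Type*} {m : MeasurableSpace Ω} {ℱ : Filtration ℝ m}

lemma predictable_le_prod : predictable ℱ ≤ (inferInstance : MeasurableSpace (ℝ × Ω)) := by
  refine MeasurableSpace.generateFrom_le ?_
  rintro _ ⟨s, A, hA, rfl⟩
  exact measurableSet_Ioi.prod (ℱ.le s A hA)

lemma measurable_fst_predictable : Measurable[predictable ℱ] (Prod.fst : ℝ × Ω → ℝ) := by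
  refine @measurable_of_Ioi ℝ (ℝ × Ω) _ _ _ (predictable ℱ) _ _ _ _ fun s => ?_
  exact MeasurableSpace.measurableSet_generateFrom
    ⟨s, Set.univ, MeasurableSet.univ, by ext; simp⟩

/-- The integrals of a function over `(-∞, u)` against an adapted random measure form a
predictable process. -/
lemma measurable_setLIntegral_Iio_predictable {n : Ω → Measure ℝ}
    [∀ ω, IsLocallyFiniteMeasure (n ω)]
    (h : ∀ s r, Measurable[ℱ r] fun ω => n ω (Set.Ioc s r)) {g : ℝ → ℝ≥0∞} (hg : Measurable g) :
    Measurable[predictable ℱ] fun z : ℝ × Ω => ∫⁻ v in Set.Iio z.1, g v ∂n z.2 := by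
  refine @measurable_of_Ioi ℝ≥0∞ (ℝ × Ω) _ _ _ (predictable ℱ) _ _ _ _ fun c => ?_
  -- Left-continuity: the integral over `(-∞, u)` is the supremum of those over `(-∞, r]` with `r <
  -- u` rational. The level set is thus a countable union of generators, the event at `r` being in
  -- `ℱ r`.
  have key : (fun z : ℝ × Ω => ∫⁻ v in Set.Iio z.1, g v ∂n z.2) ⁻¹' Set.Ioi c
      = ⋃ r : ℚ, Set.Ioi (r : ℝ) ×ˢ {ω | c < ∫⁻ v in Set.Iic (r : ℝ), g v ∂n ω} := by
    ext ⟨u, ω⟩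
    simp only [Set.mem_preimage, Set.mem_Ioi, Set.mem_iUnion, Set.mem_prod, Set.mem_ofPred_eq]
    constructor
    · intro hc
      have hU : Set.Iio u = ⋃ r : {r : ℚ // (r : ℝ) < u}, Set.Iic (r : ℝ) := by
        ext v
        simp only [Set.mem_Iio, Set.mem_iUnion, Set.mem_Iic, Subtype.exists, exists_prop]
        refine ⟨fun hv => ?_, fun ⟨r, hr, hv⟩ => hv.trans_lt hr⟩
        obtain ⟨r, h₁, h₂⟩ := exists_rat_btwn hv
        exact ⟨r, h₂, h₁.le⟩
      rw [hU, setLIntegral_iUnion_of_directed, lt_iSup_iff] at hc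
      · obtain ⟨r, hr⟩ := hc
        exact ⟨r, r.2, hr⟩
      · refine Monotone.directed_le fun i j hij => Set.Iic_subset_Iic.2 ?_
        exact_mod_cast hij
    · rintro ⟨r, hr, hc⟩
      exact hc.trans_le (lintegral_mono_set fun v hv => lt_of_le_of_lt hv hr)
  rw [key]
  refine @MeasurableSet.iUnion _ _ (predictable ℱ) _ _ fun r => ?_
  refine MeasurableSpace.measurableSet_generateFrom ⟨r, _, ?_, rfl⟩
  exact @measurable_setLIntegral_Iic Ω (ℱ r) n _ r (fun s q hq => (h s q).mono (ℱ.mono hq) le_rfl)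
    g hg _ measurableSet_Ioi

end Predictable

end MultiKernelHawkes

namespace MultiKernelHawkes

/-! ### Products of exponentially damped masses, for fixed measures. -/

section Pathwise

/-- The product of two integrals over `(-∞, t)`, split along the diagonal. -/
lemma setLIntegral_Iio_mul_setLIntegral_Iio (ν₁ ν₂ : Measure ℝ) [SFinite ν₁] [SFinite ν₂] (t : ℝ)
    {f g : ℝ → ℝ≥0∞} (hf : Measurable f) (hg : Measurable g) :
    (∫⁻ v in Set.Iio t, f v ∂ν₁) * ∫⁻ w in Set.Iio t, g w ∂ν₂
      = (∫⁻ w in Set.Iio t, g w * ∫⁻ v in Set.Iio w, f v ∂ν₁ ∂ν₂)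
        + (∫⁻ v in Set.Iio t, f v * ∫⁻ w in Set.Iio v, g w ∂ν₂ ∂ν₁)
        + ∫⁻ w in Set.Iio t, f w * g w * ν₁ {w} ∂ν₂ := by
  have hA : MeasurableSet {z : ℝ × ℝ | z.1 < z.2} := measurableSet_lt measurable_fst measurable_snd
  have hB : MeasurableSet {z : ℝ × ℝ | z.2 < z.1} := measurableSet_lt measurable_snd measurable_fst
  have hD : MeasurableSet {z : ℝ × ℝ | z.1 = z.2} :=
    measurableSet_eq_fun measurable_fst measurable_snd
  let F : ℝ × ℝ → ℝ≥0∞ := fun z => f z.1 * g z.2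
  have hF : Measurable F := by fun_prop
  have hsplit : F = fun z => ({z : ℝ × ℝ | z.1 < z.2}.indicator F z
      + {z : ℝ × ℝ | z.2 < z.1}.indicator F z) + {z : ℝ × ℝ | z.1 = z.2}.indicator F z := by
    ext z
    rcases lt_trichotomy z.1 z.2 with h | h | h
    · simp [Set.indicator, h, h.not_gt, h.ne]
    · simp [Set.indicator, h]
    · simp [Set.indicator, h, h.not_gt, h.ne']
  rw [← lintegral_prod_mul hf.aemeasurable hg.aemeasurable]
  change ∫⁻ z, F z ∂_ = _
  rw [hsplit, lintegral_add_right _ (hF.indicator hD), lintegral_add_right _ (hF.indicator hB),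
    lintegral_prod_symm' _ (hF.indicator hA), lintegral_prod _ (hF.indicator hB).aemeasurable,
    lintegral_prod_symm' _ (hF.indicator hD)]
  congr 1
  · congr 1
    · refine setLIntegral_congr_fun measurableSet_Iio fun w hw => ?_
      have : (fun v => {z : ℝ × ℝ | z.1 < z.2}.indicator F (v, w))
          = (Set.Iio w).indicator fun v => g w * f v := by
        ext v; simp [Set.indicator, F, mul_comm]
      change ∫⁻ v in Set.Iio t, (fun v => {z : ℝ × ℝ | z.1 < z.2}.indicator F (v, w)) v ∂ν₁ = _
      rw [this, setLIntegral_indicator measurableSet_Iio,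
        Set.inter_eq_left.2 (Set.Iio_subset_Iio (le_of_lt hw)), lintegral_const_mul _ hf]
    · refine setLIntegral_congr_fun measurableSet_Iio fun v hv => ?_
      have : (fun w => {z : ℝ × ℝ | z.2 < z.1}.indicator F (v, w))
          = (Set.Iio v).indicator fun w => f v * g w := by
        ext w; simp [Set.indicator, F]
      change ∫⁻ w in Set.Iio t, (fun w => {z : ℝ × ℝ | z.2 < z.1}.indicator F (v, w)) w ∂ν₂ = _
      rw [this, setLIntegral_indicator measurableSet_Iio,
        Set.inter_eq_left.2 (Set.Iio_subset_Iio (le_of_lt hv)), lintegral_const_mul _ hg]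
  · refine setLIntegral_congr_fun measurableSet_Iio fun w hw => ?_
    have : (fun v => {z : ℝ × ℝ | z.1 = z.2}.indicator F (v, w))
        = ({w} : Set ℝ).indicator fun _ => f w * g w := by
      ext v
      by_cases h : v = w <;> simp [Set.indicator, F, h]
    change ∫⁻ v in Set.Iio t, (fun v => {z : ℝ × ℝ | z.1 = z.2}.indicator F (v, w)) v ∂ν₁ = _
    rw [this, setLIntegral_indicator (measurableSet_singleton w),
      Set.inter_eq_left.2 (Set.singleton_subset_iff.2 hw), setLIntegral_const]

/-- The exponentially damped mass `∫_{(-∞, t)} exp (-b (t - v)) dν(v)`. -/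
noncomputable def damped (b : ℝ) (ν : Measure ℝ) (t : ℝ) : ℝ≥0∞ :=
  ∫⁻ v in Set.Iio t, ENNReal.ofReal (Real.exp (-b * (t - v))) ∂ν

lemma damped_eq_mul (b : ℝ) (ν : Measure ℝ) (t s : ℝ) :
    ENNReal.ofReal (Real.exp (-b * (s - t))) * damped b ν t
      = ∫⁻ v in Set.Iio t, ENNReal.ofReal (Real.exp (-b * (s - v))) ∂ν := by
  rw [damped, ← lintegral_const_mul _ (by fun_prop)]
  refine lintegral_congr fun v => ?_
  rw [← ENNReal.ofReal_mul (Real.exp_pos _).le, ← Real.exp_add]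
  ring_nf

/-- Pulling out `exp (-b t)` leaves an integrand that does not depend on the endpoint `t`. -/
lemma measurable_damped_predictable {Ω : Type*} {m : MeasurableSpace Ω} {ℱ : Filtration ℝ m}
    {n : Ω → Measure ℝ} [∀ ω, IsLocallyFiniteMeasure (n ω)]
    (h : ∀ s r, Measurable[ℱ r] fun ω => n ω (Set.Ioc s r)) (b : ℝ) :
    Measurable[predictable ℱ] fun z : ℝ × Ω => damped b (n z.2) z.1 := by
  have key : ∀ z : ℝ × Ω, damped b (n z.2) z.1 = ENNReal.ofReal (Real.exp (-b * z.1))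
      * ∫⁻ v in Set.Iio z.1, ENNReal.ofReal (Real.exp (-b * (0 - v))) ∂n z.2 := fun z => by
    rw [← damped_eq_mul, ← mul_assoc, ← ENNReal.ofReal_mul (Real.exp_pos _).le, ← Real.exp_add]
    simp
  simp_rw [key]
  have h₁ : Measurable fun x : ℝ => ENNReal.ofReal (Real.exp (-b * x)) := by fun_prop
  exact (h₁.comp measurable_fst_predictable).mul
    (measurable_setLIntegral_Iio_predictable h (by fun_prop))

lemma measurable_damped (b : ℝ) (ν : Measure ℝ) : Measurable (damped b ν) := by
  have hm : Monotone fun t => ∫⁻ v in Set.Iio t, ENNReal.ofReal (Real.exp (-b * (0 - v))) ∂ν :=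
    fun s t hst => lintegral_mono_set (Set.Iio_subset_Iio hst)
  have key : damped b ν = fun t => ENNReal.ofReal (Real.exp (-b * t))
      * ∫⁻ v in Set.Iio t, ENNReal.ofReal (Real.exp (-b * (0 - v))) ∂ν := by
    ext t
    rw [← damped_eq_mul, ← mul_assoc, ← ENNReal.ofReal_mul (Real.exp_pos _).le, ← Real.exp_add]
    simp
  rw [key]
  exact Measurable.mul (by fun_prop) hm.measurable

/-- From the later of the two points up to `t` both factors decay, at joint rate `b + c`; before it
only the factor of the earlier point does, which reassembles into a damped mass at the later point.
-/
lemma damped_mul_damped (ν₁ ν₂ : Measure ℝ) [SFinite ν₁] [SFinite ν₂] (b c t : ℝ) :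
    damped b ν₁ t * damped c ν₂ t
      = (∫⁻ w in Set.Iio t, ENNReal.ofReal (Real.exp (-(b + c) * (t - w))) * damped b ν₁ w ∂ν₂)
        + (∫⁻ v in Set.Iio t, ENNReal.ofReal (Real.exp (-(b + c) * (t - v))) * damped c ν₂ v ∂ν₁)
        + ∫⁻ w in Set.Iio t, ENNReal.ofReal (Real.exp (-(b + c) * (t - w))) * ν₁ {w} ∂ν₂ := by
  have hexp : ∀ x, ENNReal.ofReal (Real.exp (-(b + c) * x))
      = ENNReal.ofReal (Real.exp (-b * x)) * ENNReal.ofReal (Real.exp (-c * x)) := fun x => by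
    rw [← ENNReal.ofReal_mul (Real.exp_pos _).le, ← Real.exp_add]
    ring_nf
  conv_lhs => rw [damped, damped]
  rw [setLIntegral_Iio_mul_setLIntegral_Iio _ _ _ (by fun_prop) (by fun_prop)]
  simp_rw [← damped_eq_mul, hexp]
  congr 2 <;> refine lintegral_congr fun w => ?_ <;> ring

lemma integrableOn_exp_mul_toReal_damped {b c : ℝ} {ν₁ ν₂ : Measure ℝ} {t : ℝ}
    (h : ∀ w, damped b ν₁ w ≠ ∞)
    (hfin : ∫⁻ w in Set.Iio t, ENNReal.ofReal (Real.exp (-c * (t - w))) * damped b ν₁ w ∂ν₂ ≠ ∞) :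
    IntegrableOn (fun w => Real.exp (-c * (t - w)) * (damped b ν₁ w).toReal) (Set.Iio t) ν₂ ∧
      ∫ w in Set.Iio t, Real.exp (-c * (t - w)) * (damped b ν₁ w).toReal ∂ν₂
        = (∫⁻ w in Set.Iio t,
            ENNReal.ofReal (Real.exp (-c * (t - w))) * damped b ν₁ w ∂ν₂).toReal := by
  have hmeas : AEMeasurable (fun w => ENNReal.ofReal (Real.exp (-c * (t - w))) * damped b ν₁ w)
      (ν₂.restrict (Set.Iio t)) :=
    (Measurable.mul (by fun_prop) (measurable_damped b ν₁)).aemeasurable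
  have heq : (fun w => Real.exp (-c * (t - w)) * (damped b ν₁ w).toReal)
      = fun w => (ENNReal.ofReal (Real.exp (-c * (t - w))) * damped b ν₁ w).toReal := by
    ext w
    rw [ENNReal.toReal_mul, ENNReal.toReal_ofReal (Real.exp_pos _).le]
  rw [heq]
  exact ⟨integrable_toReal_of_lintegral_ne_top hmeas hfin, integral_toReal hmeas
    (.of_forall fun w => ENNReal.mul_lt_top ENNReal.ofReal_lt_top (h w).lt_top)⟩

/-- Integrability costs nothing: the three non-negative terms add up to a product of two finite
quantities. -/
lemma toReal_damped_mul_toReal_damped (ν₁ ν₂ : Measure ℝ) [SFinite ν₁] [SFinite ν₂] {b c : ℝ}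
    (h₁ : ∀ w, damped b ν₁ w ≠ ∞) (h₂ : ∀ w, damped c ν₂ w ≠ ∞) (t : ℝ) :
    IntegrableOn (fun w => Real.exp (-(b + c) * (t - w)) * (damped b ν₁ w).toReal)
        (Set.Iio t) ν₂ ∧
      IntegrableOn (fun v => Real.exp (-(b + c) * (t - v)) * (damped c ν₂ v).toReal)
        (Set.Iio t) ν₁ ∧
      (damped b ν₁ t).toReal * (damped c ν₂ t).toReal
        = (∫ w in Set.Iio t, Real.exp (-(b + c) * (t - w)) * (damped b ν₁ w).toReal ∂ν₂)
          + (∫ v in Set.Iio t, Real.exp (-(b + c) * (t - v)) * (damped c ν₂ v).toReal ∂ν₁)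
          + (∫⁻ w in Set.Iio t,
              ENNReal.ofReal (Real.exp (-(b + c) * (t - w))) * ν₁ {w} ∂ν₂).toReal := by
  have hmul := damped_mul_damped ν₁ ν₂ b c t
  have htop := ENNReal.mul_ne_top (h₁ t) (h₂ t)
  rw [hmul, ENNReal.add_ne_top, ENNReal.add_ne_top] at htop
  obtain ⟨⟨hA, hB⟩, hD⟩ := htop
  obtain ⟨hA₁, hA₂⟩ := integrableOn_exp_mul_toReal_damped h₁ hA
  obtain ⟨hB₁, hB₂⟩ := integrableOn_exp_mul_toReal_damped h₂ hB
  refine ⟨hA₁, hB₁, ?_⟩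
  rw [hA₂, hB₂, ← ENNReal.toReal_mul, hmul, ENNReal.toReal_add (ENNReal.add_ne_top.2 ⟨hA, hB⟩) hD,
    ENNReal.toReal_add hA hB]

end Pathwise

end MultiKernelHawkes

namespace MultiKernelHawkes

/-! ### The counting measures of the jump times. -/

section Counting

variable {Ω : Type*} {T : Fin 2 → Ω → Set ℝ} {j : Fin 2} {ω : Ω}

lemma measurableSet_of_finite_inter_Icc {S : Set ℝ} (h : ∀ a b, (S ∩ Set.Icc a b).Finite) :
    MeasurableSet S := by
  have : S = ⋃ k : ℕ, S ∩ Set.Icc (-(k : ℝ)) k := by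
    rw [← Set.inter_iUnion, eq_comm, Set.inter_eq_left]
    intro v _
    obtain ⟨k, hk⟩ := exists_nat_gt |v|
    have := abs_lt.1 hk
    exact Set.mem_iUnion.2 ⟨k, this.1.le, this.2.le⟩
  rw [this]
  exact .iUnion fun k => (h _ _).measurableSet

lemma isLocallyFiniteMeasure_counting (h : ∀ a b, (T j ω ∩ Set.Icc a b).Finite) :
    IsLocallyFiniteMeasure (counting T j ω) := by
  refine ⟨fun x => ⟨Set.Icc (x - 1) (x + 1), Icc_mem_nhds (by linarith) (by linarith), ?_⟩⟩
  rw [counting, Measure.restrict_apply measurableSet_Icc, Set.inter_comm]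
  exact Measure.count_apply_lt_top.2 (h _ _)

lemma counting_singleton (w : ℝ) [Decidable (w ∈ T j ω)] :
    counting T j ω {w} = if w ∈ T j ω then 1 else 0 := by
  rw [counting, Measure.restrict_apply (measurableSet_singleton w)]
  split_ifs with h
  · rw [Set.inter_eq_left.2 (Set.singleton_subset_iff.2 h), Measure.count_singleton]
  · rw [Set.singleton_inter_eq_empty.2 h, measure_empty]

lemma ae_mem_counting (h : MeasurableSet (T j ω)) : ∀ᵐ w ∂counting T j ω, w ∈ T j ω :=
  ae_restrict_mem h

end Counting

/-! ### The pathwise product formula for the stacked vector. -/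

section Stacked

variable {Ω : Type*} {K : ℕ} {α : Fin K → Matrix (Fin 2) (Fin 2) ℝ} {β : Fin K → Fin 2 → ℝ}
  {T : Fin 2 → Ω → Set ℝ}

lemma stacked_eq_sum_damped (t : ℝ) (ω : Ω) (p : Fin K × Fin 2) :
    stacked α β T t ω p
      = ∑ j, α p.1 p.2 j * (damped (β p.1 p.2) (counting T j ω) t).toReal := by
  refine Finset.sum_congr rfl fun j _ => ?_
  simp only [kernel, Matrix.hadamard_apply, Matrix.of_apply]
  rw [integral_const_mul, integral_eq_lintegral_of_nonneg_ae
    (.of_forall fun _ => (Real.exp_pos _).le) (by fun_prop), damped]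

/-- A vanishing coefficient makes the kernel zero, and its integrability then says nothing about the
damped mass. -/
lemma damped_ne_top_of_integrableOn_kernel {t : ℝ} {ω : Ω} {p : Fin K × Fin 2} {j : Fin 2}
    (hα : α p.1 p.2 j ≠ 0)
    (h : IntegrableOn (fun u => kernel α β p.1 (t - u) p.2 j) (Set.Iio t) (counting T j ω)) :
    damped (β p.1 p.2) (counting T j ω) t ≠ ∞ := by
  simp only [kernel, Matrix.hadamard_apply, Matrix.of_apply] at h
  have h' : IntegrableOn (fun u => Real.exp (-(β p.1 p.2) * (t - u))) (Set.Iio t)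
      (counting T j ω) := by
    have := h.const_mul (α p.1 p.2 j)⁻¹
    simpa [IntegrableOn, ← mul_assoc, inv_mul_cancel₀ hα] using this
  have := h'.2
  rw [hasFiniteIntegral_iff_ofReal (.of_forall fun _ => (Real.exp_pos _).le)] at this
  exact this.ne

/-- The diagonal term of the product of two damped masses: distinct components do not jump
together. -/
lemma setLIntegral_mul_counting_singleton {ω : Ω} (hm : ∀ j, MeasurableSet (T j ω))
    (hd : Disjoint (T 0 ω) (T 1 ω)) (s : Set ℝ) (f : ℝ → ℝ≥0∞) (j l : Fin 2) :
    ∫⁻ w in s, f w * counting T j ω {w} ∂counting T l ω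
      = if j = l then ∫⁻ w in s, f w ∂counting T j ω else 0 := by
  classical
  split_ifs with hjl
  · subst hjl
    refine lintegral_congr_ae ?_
    filter_upwards [ae_restrict_of_ae (ae_mem_counting (hm j))] with w hw
    simp [counting_singleton, hw]
  · rw [lintegral_eq_zero_of_ae_eq_zero]
    filter_upwards [ae_restrict_of_ae (ae_mem_counting (hm l))] with w hw
    have hdis : Disjoint (T l ω) (T j ω) := by
      fin_cases j <;> fin_cases l <;> first | exact absurd rfl hjl | exact hd | exact hd.symm
    simp [counting_singleton, Set.disjoint_left.1 hdis hw]

/-- Two components of the stacked vector, multiplied: the contributions of pairs of jumps at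
different times and of single jumps. -/
lemma stacked_mul_stacked {ω : Ω} (hfin : ∀ j a b, (T j ω ∩ Set.Icc a b).Finite)
    (hd : Disjoint (T 0 ω) (T 1 ω))
    (hint : ∀ t k i j,
      IntegrableOn (fun u => kernel α β k (t - u) i j) (Set.Iio t) (counting T j ω))
    (t : ℝ) (p q : Fin K × Fin 2) :
    stacked α β T t ω p * stacked α β T t ω q
      = (∑ l, α q.1 q.2 l * ∫ w in Set.Iio t,
          Real.exp (-(β p.1 p.2 + β q.1 q.2) * (t - w)) * stacked α β T w ω p ∂counting T l ω)
        + (∑ l, α p.1 p.2 l * ∫ w in Set.Iio t,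
          Real.exp (-(β p.1 p.2 + β q.1 q.2) * (t - w)) * stacked α β T w ω q ∂counting T l ω)
        + ∑ l, α p.1 p.2 l * α q.1 q.2 l * ∫ w in Set.Iio t,
          Real.exp (-(β p.1 p.2 + β q.1 q.2) * (t - w)) ∂counting T l ω := by
  have hm : ∀ j, MeasurableSet (T j ω) := fun j => measurableSet_of_finite_inter_Icc (hfin j)
  have hlf : ∀ j, IsLocallyFiniteMeasure (counting T j ω) := fun j =>
    isLocallyFiniteMeasure_counting (hfin j)
  let e : ℝ → ℝ := fun w => Real.exp (-(β p.1 p.2 + β q.1 q.2) * (t - w))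
  let y : Fin K × Fin 2 → Fin 2 → ℝ → ℝ := fun p j w =>
    (damped (β p.1 p.2) (counting T j ω) w).toReal
  -- The coefficients stay inside the integrands: where one vanishes, the damped mass may be
  -- infinite but the statement is trivial.
  have hpair : ∀ j l,
      IntegrableOn (fun w => α p.1 p.2 j * α q.1 q.2 l * (e w * y p j w)) (Set.Iio t)
        (counting T l ω) ∧
      IntegrableOn (fun w => α p.1 p.2 j * α q.1 q.2 l * (e w * y q l w)) (Set.Iio t)
        (counting T j ω) ∧
      α p.1 p.2 j * α q.1 q.2 l * (y p j t * y q l t)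
        = (∫ w in Set.Iio t, α p.1 p.2 j * α q.1 q.2 l * (e w * y p j w) ∂counting T l ω)
          + (∫ w in Set.Iio t, α p.1 p.2 j * α q.1 q.2 l * (e w * y q l w) ∂counting T j ω)
          + if j = l then α p.1 p.2 j * α q.1 q.2 l * ∫ w in Set.Iio t, e w ∂counting T j ω
            else 0 := by
    intro j l
    by_cases hp : α p.1 p.2 j = 0
    · simp [hp]
    by_cases hq : α q.1 q.2 l = 0
    · simp [hq]
    obtain ⟨h₁, h₂, h₃⟩ := toReal_damped_mul_toReal_damped (counting T j ω) (counting T l ω)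
      (fun w => damped_ne_top_of_integrableOn_kernel hp (hint w p.1 p.2 j))
      (fun w => damped_ne_top_of_integrableOn_kernel hq (hint w q.1 q.2 l)) t
    refine ⟨h₁.const_mul _, h₂.const_mul _, ?_⟩
    have hdiag : (if j = l then ∫⁻ w in Set.Iio t, ENNReal.ofReal (e w) ∂counting T j ω
        else 0).toReal = if j = l then ∫ w in Set.Iio t, e w ∂counting T j ω else 0 := by
      split_ifs
      · rw [integral_eq_lintegral_of_nonneg_ae (.of_forall fun _ => (Real.exp_pos _).le)
          (by fun_prop)]
      · simp
    rw [setLIntegral_mul_counting_singleton hm hd, hdiag] at h₃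
    change α p.1 p.2 j * α q.1 q.2 l * ((damped (β p.1 p.2) (counting T j ω) t).toReal
      * (damped (β q.1 q.2) (counting T l ω) t).toReal) = _
    rw [h₃, integral_const_mul, integral_const_mul]
    split_ifs <;> ring
  have hX : ∀ (p : Fin K × Fin 2) w, stacked α β T w ω p = ∑ j, α p.1 p.2 j * y p j w :=
    fun p w => stacked_eq_sum_damped w ω p
  have hfst : ∀ l, α q.1 q.2 l * ∫ w in Set.Iio t, e w * stacked α β T w ω p ∂counting T l ω
      = ∑ j, ∫ w in Set.Iio t, α p.1 p.2 j * α q.1 q.2 l * (e w * y p j w) ∂counting T l ω := by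
    intro l
    rw [← integral_finsetSum _ fun j _ => (hpair j l).1, ← integral_const_mul]
    refine integral_congr_ae (.of_forall fun w => ?_)
    simp only [hX, Finset.mul_sum]
    exact Finset.sum_congr rfl fun j _ => by ring
  have hsnd : ∀ j, α p.1 p.2 j * ∫ w in Set.Iio t, e w * stacked α β T w ω q ∂counting T j ω
      = ∑ l, ∫ w in Set.Iio t, α p.1 p.2 j * α q.1 q.2 l * (e w * y q l w) ∂counting T j ω := by
    intro j
    rw [← integral_finsetSum _ fun l _ => (hpair j l).2.1, ← integral_const_mul]
    refine integral_congr_ae (.of_forall fun w => ?_)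
    simp only [hX, Finset.mul_sum]
    exact Finset.sum_congr rfl fun l _ => by ring
  refine Eq.trans ?_ (congrArg (· + _) (congrArg₂ (· + ·)
    (Finset.sum_congr rfl fun l _ => (hfst l).symm)
    (Finset.sum_congr rfl fun j _ => (hsnd j).symm)))
  change _ = _ + ∑ l, α p.1 p.2 l * α q.1 q.2 l * ∫ w in Set.Iio t, e w ∂counting T l ω
  rw [hX, hX, Finset.sum_mul_sum, Finset.sum_comm (s := (Finset.univ : Finset (Fin 2))) (f := fun l j =>
    ∫ w in Set.Iio t, α p.1 p.2 j * α q.1 q.2 l * (e w * y p j w) ∂counting T l ω),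
    ← Finset.sum_add_distrib, ← Finset.sum_add_distrib]
  refine Finset.sum_congr rfl fun j _ => ?_
  -- The single sum over simultaneous jumps becomes a double sum supported on `j = l`, so that
  -- `hpair` applies term by term.
  have hsum : α p.1 p.2 j * α q.1 q.2 j * ∫ w in Set.Iio t, e w ∂counting T j ω
      = ∑ l, if j = l then α p.1 p.2 j * α q.1 q.2 l * ∫ w in Set.Iio t, e w ∂counting T j ω
        else 0 := by simp
  rw [hsum, ← Finset.sum_add_distrib, ← Finset.sum_add_distrib]
  refine Finset.sum_congr rfl fun l _ => ?_
  rw [← (hpair j l).2.2]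
  ring

end Stacked

end MultiKernelHawkes

namespace MultiKernelHawkes

/-! ### Expectations in the steady state and the Sylvester equation. -/

section Hawkes

variable {Ω : Type*} {m : MeasurableSpace Ω} {P : Measure Ω} {ℱ : Filtration ℝ m} {K : ℕ}
  {μ : Fin 2 → ℝ} {α : Fin K → Matrix (Fin 2) (Fin 2) ℝ} {β : Fin K → Fin 2 → ℝ}
  {T : Fin 2 → Ω → Set ℝ}

lemma IsHawkes.isLocallyFiniteMeasure_counting (hT : IsHawkes P ℱ μ α β T) (j : Fin 2) (ω : Ω) :
    IsLocallyFiniteMeasure (counting T j ω) :=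
  MultiKernelHawkes.isLocallyFiniteMeasure_counting (hT.locallyFinite j ω)

lemma IsHawkes.measurable_stacked_predictable (hT : IsHawkes P ℱ μ α β T) :
    Measurable[predictable ℱ] fun z : ℝ × Ω => stacked α β T z.1 z.2 := by
  have := hT.isLocallyFiniteMeasure_counting
  refine @measurable_pi_lambda _ _ _ (predictable ℱ) _ _ fun p => ?_
  simp_rw [stacked_eq_sum_damped]
  exact Finset.measurable_fun_sum _ fun j _ =>
    (measurable_damped_predictable (hT.adapted j) _).ennreal_toReal.const_mul _

lemma IsHawkes.measurable_stacked (hT : IsHawkes P ℱ μ α β T) :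
    Measurable fun z : ℝ × Ω => stacked α β T z.1 z.2 :=
  hT.measurable_stacked_predictable.mono predictable_le_prod le_rfl

lemma lintegral_Iio_exp {γ : ℝ} (hγ : 0 < γ) (t : ℝ) :
    ∫⁻ w in Set.Iio t, ENNReal.ofReal (Real.exp (-γ * (t - w))) = ENNReal.ofReal γ⁻¹ := by
  have hfun : (fun w => Real.exp (-γ * (t - w)))
      = fun w => Real.exp (-γ * t) * Real.exp (γ * w) := by
    ext w
    rw [← Real.exp_add]
    ring_nf
  have hi : IntegrableOn (fun w => Real.exp (-γ * (t - w))) (Set.Iic t) := by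
    rw [hfun]
    exact (integrableOn_exp_mul_Iic hγ t).const_mul _
  rw [setLIntegral_congr Iio_ae_eq_Iic, ← ofReal_integral_eq_lintegral_ofReal hi
    (.of_forall fun _ => (Real.exp_pos _).le), hfun, integral_const_mul, integral_exp_mul_Iic hγ,
    ← mul_div_assoc, ← Real.exp_add]
  simp

/-- In the steady state, the expected damped sum of `F (Λ_w)` over the jumps `w < t`. -/
lemma IsHawkes.lintegral_setLIntegral_exp_mul [SFinite P] (hT : IsHawkes P ℱ μ α β T)
    (hsteady : IsSteadyState P α β T) {γ : ℝ} (hγ : 0 < γ) (t : ℝ) (l : Fin 2)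
    {F : (Fin K × Fin 2 → ℝ) → ℝ≥0∞} (hF : Measurable F) :
    ∫⁻ ω, ∫⁻ w in Set.Iio t, ENNReal.ofReal (Real.exp (-γ * (t - w))) * F (stacked α β T w ω)
        ∂counting T l ω ∂P
      = ENNReal.ofReal γ⁻¹
        * ∫⁻ ω, F (stacked α β T t ω) * ENNReal.ofReal (intensity μ α β T t ω l) ∂P := by
  let e : ℝ → ℝ≥0∞ := (Set.Iio t).indicator fun w => ENNReal.ofReal (Real.exp (-γ * (t - w)))
  have he : Measurable e := Measurable.indicator (by fun_prop) measurableSet_Iio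
  have hC : Measurable[predictable ℱ] fun z : ℝ × Ω => e z.1 * F (stacked α β T z.1 z.2) :=
    (he.comp measurable_fst_predictable).mul (hF.comp hT.measurable_stacked_predictable)
  have hleft : ∀ ω, ∫⁻ w in Set.Iio t, ENNReal.ofReal (Real.exp (-γ * (t - w)))
      * F (stacked α β T w ω) ∂counting T l ω
      = ∫⁻ w, e w * F (stacked α β T w ω) ∂counting T l ω := fun ω => by
    rw [← lintegral_indicator measurableSet_Iio]
    exact lintegral_congr fun w => Set.indicator_mul_left _ _ _
  -- The intensity is a function of `Λ`, so the law of `Λ_w` alone determines the expectation of the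
  -- product.
  let Φ : (Fin K × Fin 2 → ℝ) → ℝ≥0∞ := fun x => F x * ENNReal.ofReal (μ l + ∑ k, x (k, l))
  have hΦ : Measurable Φ := by fun_prop
  have hmean : ∀ w, ∫⁻ ω, Φ (stacked α β T w ω) ∂P = ∫⁻ ω, Φ (stacked α β T t ω) ∂P := fun w =>
    (((hsteady w).comp hΦ).lintegral_eq).trans (((hsteady t).comp hΦ).lintegral_eq).symm
  have hmeas := hT.measurable_stacked
  simp_rw [hleft]
  rw [hT.isIntensity l _ hC]
  change ∫⁻ ω, ∫⁻ w, e w * F (stacked α β T w ω)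
      * ENNReal.ofReal (μ l + ∑ k, stacked α β T w ω (k, l)) ∂_ ∂P
    = _ * ∫⁻ ω, Φ (stacked α β T t ω) ∂P
  simp_rw [mul_assoc]
  change ∫⁻ ω, ∫⁻ w, e w * Φ (stacked α β T w ω) ∂_ ∂P = _
  have hsec : ∀ w, Measurable fun ω => Φ (stacked α β T w ω) := fun w =>
    hΦ.comp (hmeas.comp measurable_prodMk_left)
  have hinner : ∀ w, ∫⁻ ω, e w * Φ (stacked α β T w ω) ∂P
      = e w * ∫⁻ ω, Φ (stacked α β T t ω) ∂P := fun w => by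
    rw [lintegral_const_mul _ (hsec w), hmean]
  rw [lintegral_lintegral_swap]
  · rw [lintegral_congr hinner, lintegral_mul_const _ he, lintegral_indicator measurableSet_Iio, lintegral_Iio_exp hγ]
  · exact ((he.comp measurable_snd).mul (hΦ.comp (hmeas.comp measurable_swap))).aemeasurable

/-- The coefficients `α` may be negative, hence so may `Λ`: the non-negative identity is applied to
positive and negative parts, and `hint` keeps both finite. -/
lemma IsHawkes.integral_setIntegral_exp_mul [SFinite P] (hT : IsHawkes P ℱ μ α β T)
    (hsteady : IsSteadyState P α β T) {γ : ℝ} (hγ : 0 < γ) (t : ℝ) (l : Fin 2)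
    {F : (Fin K × Fin 2 → ℝ) → ℝ} (hF : Measurable F)
    (hint : Integrable (fun ω => F (stacked α β T t ω) * intensity μ α β T t ω l) P) :
    Integrable (fun ω => ∫ w in Set.Iio t,
        Real.exp (-γ * (t - w)) * F (stacked α β T w ω) ∂counting T l ω) P ∧
      ∫ ω, ∫ w in Set.Iio t, Real.exp (-γ * (t - w)) * F (stacked α β T w ω) ∂counting T l ω ∂P
        = γ⁻¹ * ∫ ω, F (stacked α β T t ω) * intensity μ α β T t ω l ∂P := by
  have := hT.isLocallyFiniteMeasure_counting l
  let G : ℝ × Ω → ℝ := (Prod.fst ⁻¹' Set.Iio t).indicator fun z =>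
    Real.exp (-γ * (t - z.1)) * F (stacked α β T z.1 z.2)
  have hG : Measurable G :=
    (Measurable.mul (by fun_prop) (hF.comp hT.measurable_stacked)).indicator
      (measurable_fst measurableSet_Iio)
  have hGint : ∀ ω, ∫ w in Set.Iio t, Real.exp (-γ * (t - w)) * F (stacked α β T w ω)
      ∂counting T l ω = ∫ w, G (w, ω) ∂counting T l ω := fun ω => by
    rw [← integral_indicator measurableSet_Iio]
    rfl
  have hae : ∀ᵐ ω ∂P, 0 ≤ intensity μ α β T t ω l := hT.nonneg.mono fun ω h => h t l
  -- Positive part, negative part and norm are handled at once: each is positively homogeneous, so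
  -- the exponential weight and the non-negative intensity pass through `f`.
  have hmap : ∀ (f : ℝ → ℝ≥0∞), Measurable f → f 0 = 0 →
      (∀ x y, 0 ≤ x → f (x * y) = ENNReal.ofReal x * f y) →
      ∫⁻ ω, ∫⁻ w, f (G (w, ω)) ∂counting T l ω ∂P = ENNReal.ofReal γ⁻¹
        * ∫⁻ ω, f (F (stacked α β T t ω) * intensity μ α β T t ω l) ∂P := fun f hf hf0 hfm => by
    have h₁ : ∀ ω, ∫⁻ w, f (G (w, ω)) ∂counting T l ω = ∫⁻ w in Set.Iio t,
        ENNReal.ofReal (Real.exp (-γ * (t - w))) * f (F (stacked α β T w ω))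
          ∂counting T l ω := fun ω => by
      rw [← lintegral_indicator measurableSet_Iio]
      refine lintegral_congr fun w => ?_
      by_cases hw : w < t
      · simp only [G, Set.indicator, Set.mem_preimage, Set.mem_Iio, hw, if_true]
        exact hfm _ _ (Real.exp_pos _).le
      · simp [G, Set.indicator, hw, hf0]
    simp_rw [h₁]
    refine (hT.lintegral_setLIntegral_exp_mul hsteady hγ t l (hf.comp hF)).trans ?_
    congr 1
    refine lintegral_congr_ae ?_
    filter_upwards [hae] with ω hω
    rw [mul_comm (F _), hfm _ _ hω, mul_comm]
    rfl
  have hpos := hmap ENNReal.ofReal ENNReal.measurable_ofReal ENNReal.ofReal_zero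
    fun x y hx => ENNReal.ofReal_mul hx
  have hneg := hmap (fun x => ENNReal.ofReal (-x)) (by fun_prop) (by simp)
    fun x y hx => by rw [← mul_neg, ENNReal.ofReal_mul hx]
  have hnorm := hmap (fun x => ‖x‖ₑ) (by fun_prop) (by simp)
    fun x y hx => by rw [enorm_mul, Real.enorm_of_nonneg hx]
  obtain ⟨h₁, h₂⟩ := integrable_integral_and_integral_integral_eq (P := P)
    (fun s r => (hT.adapted l s r).mono (ℱ.le r) le_rfl) hG
    (by rw [hnorm]; exact ENNReal.mul_ne_top ENNReal.ofReal_ne_top hint.2.ne)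
  simp_rw [hGint]
  refine ⟨h₁, ?_⟩
  rw [h₂, hpos, hneg, ENNReal.toReal_mul, ENNReal.toReal_mul,
    ENNReal.toReal_ofReal (inv_nonneg.2 hγ.le), ← mul_sub,
    ← integral_eq_lintegral_pos_part_sub_lintegral_neg_part hint]

/-- The entries of the stationary second moment matrix. -/
lemma IsHawkes.integral_stacked_mul_stacked [IsFiniteMeasure P] (hT : IsHawkes P ℱ μ α β T)
    (hsteady : IsSteadyState P α β T) (hβ : ∀ k i, 0 < β k i) (t : ℝ)
    (hmoment : ∀ p, MemLp (fun ω => stacked α β T t ω p) 2 P) (p q : Fin K × Fin 2) :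
    (β p.1 p.2 + β q.1 q.2) * ∫ ω, stacked α β T t ω p * stacked α β T t ω q ∂P
      = (∑ l, α q.1 q.2 l * ∫ ω, stacked α β T t ω p * intensity μ α β T t ω l ∂P)
        + (∑ l, α p.1 p.2 l * ∫ ω, stacked α β T t ω q * intensity μ α β T t ω l ∂P)
        + ∑ l, α p.1 p.2 l * α q.1 q.2 l * ∫ ω, intensity μ α β T t ω l ∂P := by
  have hγ : 0 < β p.1 p.2 + β q.1 q.2 := add_pos (hβ _ _) (hβ _ _)
  set γ := β p.1 p.2 + β q.1 q.2
  have hintens : ∀ l, MemLp (fun ω => intensity μ α β T t ω l) 2 P := fun l =>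
    (memLp_const (μ l)).add (memLp_finsetSum _ fun k _ => hmoment (k, l))
  -- Coordinates serve the terms with distinct jump times; the constant `1` below serves the
  -- diagonal term.
  have hX : ∀ p l, _ := fun (p : Fin K × Fin 2) l =>
    hT.integral_setIntegral_exp_mul hsteady hγ t l (F := fun x => x p) (by fun_prop)
      ((hmoment p).integrable_mul (hintens l))
  have h1 : ∀ l, _ := fun l =>
    hT.integral_setIntegral_exp_mul hsteady hγ t l (F := fun _ => 1) (by fun_prop)
      (by simpa using (hintens l).integrable one_le_two)
  simp only [mul_one, one_mul] at h1
  have hae := (hT.noCommonJumps.and hT.integrable).mono fun ω h =>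
    stacked_mul_stacked (fun j => hT.locallyFinite j ω) h.1 h.2 t p q
  rw [integral_congr_ae hae, integral_add, integral_add, integral_finsetSum, integral_finsetSum,
    integral_finsetSum]
  · simp_rw [integral_const_mul]
    rw [Finset.sum_congr rfl fun l _ => congrArg (α q.1 q.2 l * ·) (hX p l).2,
      Finset.sum_congr rfl fun l _ => congrArg (α p.1 p.2 l * ·) (hX q l).2,
      Finset.sum_congr rfl fun l _ => congrArg (α p.1 p.2 l * α q.1 q.2 l * ·) (h1 l).2,
      mul_add, mul_add, Finset.mul_sum, Finset.mul_sum, Finset.mul_sum]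
    congr 1
    · congr 1 <;> refine Finset.sum_congr rfl fun l _ => ?_ <;> field_simp
    · refine Finset.sum_congr rfl fun l _ => ?_
      field_simp
  · exact fun l _ => (h1 l).1.const_mul _
  · exact fun l _ => (hX q l).1.const_mul _
  · exact fun l _ => (hX p l).1.const_mul _
  · exact integrable_finsetSum _ fun l _ => (hX p l).1.const_mul _
  · exact integrable_finsetSum _ fun l _ => (hX q l).1.const_mul _
  · exact (integrable_finsetSum _ fun l _ => (hX p l).1.const_mul _).add
      (integrable_finsetSum _ fun l _ => (hX q l).1.const_mul _)
  · exact integrable_finsetSum _ fun l _ => (h1 l).1.const_mul _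

lemma IsHawkes.sylvester [IsFiniteMeasure P] (hT : IsHawkes P ℱ μ α β T)
    (hsteady : IsSteadyState P α β T) (hβ : ∀ k i, 0 < β k i) (t : ℝ)
    (hmoment : ∀ p, MemLp (fun ω => stacked α β T t ω p) 2 P) :
    (stackedBeta β - stackedAlpha α * matJ K) * secondMoment P (stacked α β T t)
        + secondMoment P (stacked α β T t) * (stackedBeta β - (matJ K)ᵀ * (stackedAlpha α)ᵀ)
      = rhs P μ α β T t := by
  have hmix : ∀ (p : Fin K × Fin 2) l, ∫ ω, stacked α β T t ω p * intensity μ α β T t ω l ∂P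
      = μ l * mean P (stacked α β T t) p
        + ∑ k, secondMoment P (stacked α β T t) p (k, l) := fun p l => by
    simp only [intensity, mul_add, Finset.mul_sum, mean, secondMoment, Matrix.of_apply]
    rw [integral_add, integral_finsetSum, integral_mul_const, mul_comm]
    · exact fun k _ => (hmoment p).integrable_mul (hmoment (k, l))
    · exact ((hmoment p).integrable one_le_two).mul_const _
    · exact integrable_finsetSum _ fun k _ => (hmoment p).integrable_mul (hmoment (k, l))
  have hsymm : ∀ p q, secondMoment P (stacked α β T t) p q
      = secondMoment P (stacked α β T t) q p := fun p q => by
    simp only [secondMoment, Matrix.of_apply, mul_comm]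
  have hJ : ∀ (X : Matrix (Fin K × Fin 2) (Fin K × Fin 2) ℝ) l q,
      (matJ K * X) l q = ∑ k, X (k, l) q := fun X l q => by
    simp [Matrix.mul_apply, matJ, Fintype.sum_prod_type, ite_mul]
  have hJt : ∀ (X : Matrix (Fin K × Fin 2) (Fin K × Fin 2) ℝ) l q,
      (X * (matJ K)ᵀ) q l = ∑ k, X q (k, l) := fun X l q => by
    simp [Matrix.mul_apply, matJ, Fintype.sum_prod_type, mul_ite]
  have hA : ∀ (Y : Matrix (Fin 2) (Fin K × Fin 2) ℝ) p q,
      (stackedAlpha α * Y) p q = ∑ l, α p.1 p.2 l * Y l q := fun Y p q => rfl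
  have hAt : ∀ (Y : Matrix (Fin K × Fin 2) (Fin 2) ℝ) p q,
      (Y * (stackedAlpha α)ᵀ) p q = ∑ l, Y p l * α q.1 q.2 l := fun Y p q => rfl
  have happ : ∀ p l, stackedAlpha α p l = α p.1 p.2 l := fun p l => rfl
  ext p q
  have hkey := hT.integral_stacked_mul_stacked hsteady hβ t hmoment p q
  simp only [hmix] at hkey
  change _ * secondMoment P (stacked α β T t) p q = _ + _
    + ∑ l, _ * _ * mean P (intensity μ α β T t) l at hkey
  rw [sub_mul, mul_sub, Matrix.mul_assoc, ← Matrix.mul_assoc _ (matJ K)ᵀ]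
  simp only [rhs, Matrix.add_apply, Matrix.sub_apply, stackedBeta, Matrix.diagonal_mul,
    Matrix.mul_diagonal, hA, hAt, hJ, hJt, happ, Matrix.vecMulVec_apply, Fin.sum_univ_two]
  simp only [Fin.sum_univ_two] at hkey
  -- Left multiplication by `J` sums over the row index, whereas `hkey` carries the transposed
  -- entries.
  simp only [fun l => Finset.sum_congr (s₁ := (Finset.univ : Finset (Fin K))) rfl
    fun k _ => hsymm (k, l) q]
  linear_combination hkey

end Hawkes

/-- Vectorization of `A X + X Aᵀ`. -/
lemma kronecker_add_kronecker_mulVec_vec {ι : Type*} [Fintype ι] [DecidableEq ι]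
    (A X : Matrix ι ι ℝ) :
    ((1 : Matrix ι ι ℝ) ⊗ₖ A + A ⊗ₖ 1) *ᵥ Matrix.vec X = Matrix.vec (A * X + X * Aᵀ) := by
  rw [Matrix.add_mulVec, Matrix.kronecker_mulVec_vec, Matrix.kronecker_mulVec_vec, Matrix.vec_add,
    Matrix.transpose_one, Matrix.mul_one, Matrix.one_mul]

lemma transpose_stackedBeta_sub {K : ℕ} (α : Fin K → Matrix (Fin 2) (Fin 2) ℝ)
    (β : Fin K → Fin 2 → ℝ) :
    (stackedBeta β - stackedAlpha α * matJ K)ᵀ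
      = stackedBeta β - (matJ K)ᵀ * (stackedAlpha α)ᵀ := by
  rw [Matrix.transpose_sub, Matrix.transpose_mul, stackedBeta, Matrix.diagonal_transpose]

end MultiKernelHawkes
open MultiKernelHawkes in
theorem proposition2 {Ω : Type*} {m : MeasurableSpace Ω} (P : Measure Ω) [IsProbabilityMeasure P]
    (ℱ : Filtration ℝ m) (K : ℕ) (μ : Fin 2 → ℝ) (α : Fin K → Matrix (Fin 2) (Fin 2) ℝ)
    (β : Fin K → Fin 2 → ℝ) (hβ : ∀ k i, 0 < β k i) (T : Fin 2 → Ω → Set ℝ)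
    (hT : IsHawkes P ℱ μ α β T) (hsteady : IsSteadyState P α β T) (t : ℝ)
    (hmoment : ∀ p, MemLp (fun ω => stacked α β T t ω p) 2 P) :
    (stackedBeta β - stackedAlpha α * matJ K) * secondMoment P (stacked α β T t)
        + secondMoment P (stacked α β T t) * (stackedBeta β - (matJ K)ᵀ * (stackedAlpha α)ᵀ)
      = rhs P μ α β T t
    ∧ (((1 : Matrix (Fin K × Fin 2) (Fin K × Fin 2) ℝ) ⊗ₖ (stackedBeta β - stackedAlpha α * matJ K)
        + (stackedBeta β - stackedAlpha α * matJ K) ⊗ₖ 1) *ᵥ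
          Matrix.vec (secondMoment P (stacked α β T t))
      = Matrix.vec (rhs P μ α β T t))
    ∧ ∀ X : Matrix (Fin K × Fin 2) (Fin K × Fin 2) ℝ,
      ((stackedBeta β - stackedAlpha α * matJ K) * X
          + X * (stackedBeta β - (matJ K)ᵀ * (stackedAlpha α)ᵀ) = rhs P μ α β T t
        ↔ ((1 : Matrix (Fin K × Fin 2) (Fin K × Fin 2) ℝ) ⊗ₖ
              (stackedBeta β - stackedAlpha α * matJ K)
            + (stackedBeta β - stackedAlpha α * matJ K) ⊗ₖ 1) *ᵥ Matrix.vec X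
          = Matrix.vec (rhs P μ α β T t)) := by
  have hvec : ∀ X : Matrix (Fin K × Fin 2) (Fin K × Fin 2) ℝ,
      (stackedBeta β - stackedAlpha α * matJ K) * X
          + X * (stackedBeta β - (matJ K)ᵀ * (stackedAlpha α)ᵀ) = rhs P μ α β T t
        ↔ ((1 : Matrix (Fin K × Fin 2) (Fin K × Fin 2) ℝ) ⊗ₖ
              (stackedBeta β - stackedAlpha α * matJ K)
            + (stackedBeta β - stackedAlpha α * matJ K) ⊗ₖ 1) *ᵥ Matrix.vec X
          = Matrix.vec (rhs P μ α β T t) := fun X => by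
    rw [kronecker_add_kronecker_mulVec_vec, transpose_stackedBeta_sub, Matrix.vec_inj]
  have hsylv := hT.sylvester hsteady hβ t hmoment
  exact ⟨hsylv, (hvec _).1 hsylv, hvec⟩
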